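/- Let $X$ and $Y$ be finite-dimensional, locally finite (abstract) simplicial complexes, let $f\colon X\to Y$ be a simplicial map (simplices may be collapsed), and write $f$ also for the induced map of geometric realisations. Give $Y$ its standard metric $d_Y$: the path metric for which every simplex has the Euclidean metric of its standard embedding, with $d_Y=\infty$ between different path components. For a set $M$ with a distance function $d\colon M\times M\to[0,\infty]$, spaces $A,B$ with (not necessarily continuous) control maps $p\colon A\to M$, $q\colon B\to M$, and $0<\varepsilon\le\infty$, say that $u\colon A\to B$ has control $<\varepsilon$ if $d(p(a),q(u(a)))<\varepsilon$ for all $a\in A$. A homotopy is regarded as a map from $A\times[0,1]$ (or $B\times [0,1]$), with control map the projection to $A$ (or $B$) followed by $p$ (or $q$). A continuous map $u\colon A\to B$ is an $\varepsilon$-controlled homotopy equivalence if $p=q\circ u$ and there are a continuous map $g\colon B\to A$ and homotopies $g\circ u\simeq \mathrm{id}_A$, $u\circ g\simeq\mathrm{id}_B$, all of control $<\varepsilon$. It is a bounded homotopy equivalence if, for some finite $b$, $u$ has control $<b$ and there are $g$ and homotopies as before of control $<b$. The open cone $O(Y^+)$ is the quotient of $Y\times\mathbb R$ by $(y,t)\sim(y',t)$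 for all $y,y'\in Y$ and $t\le 0$; let $j_Y\colon Y\times\mathbb R\to O(Y^+)$ be the quotient map. Let $d_{O(Y^+)}$ be the path metric on $O(Y^+)$: the infimum of the lengths of paths consisting of finitely many pieces, each either horizontal, from $(y,t)$ to $(y',t)$, of length $\max\{t,0\}\,d_Y(y,y')$ (with $0\cdot\infty=0$), or vertical, from $(y,t)$ to $(y,s)$, of length $|t-s|$. Put also $$\delta_{O(Y^+)}\big([y,t],[y',s]\big)=\max\{\min\{t,s\},0\}\,d_Y(y,y')+|t-s| .$$ Then the following are equivalent: 1. $f$ has contractible point inverses: $f^{-1}(y)$ is contractible (in particular non-empty) for every point $y$ of $Y$; 2. for every $\varepsilon>0$, $f\colon X\to Y$ is an $\varepsilon$-controlled homotopy equivalence measured in $(Y,d_Y)$, with control maps $f$ on $X$ and $\mathrm{id}$ on $Y$; 3. $f\times\mathrm{id}_{\mathbb R}\colon X\times\mathbb R\to Y\times\mathbb R$ is an $O(Y^+)$-bounded homotopy equivalence, i.e. a bounded homotopy equivalence measured in $(O(Y^+),d_{O(Y^+)})$, with control maps $j_Y\circ(f\times\mathrm{id}_{\mathbb R})$ on $X\times\mathbb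 R$ and $j_Y$ on $Y\times\mathbb R$; 4. the same as 3, with $\delta_{O(Y^+)}$ in place of $d_{O(Y^+)}$. -/

import Mathlib

open scoped ENNReal unitInterval

noncomputable section

/-! ## Simplicial complexes, geometric realisation, simplicial maps -/

namespace AbstractSimplicialComplex

variable {V W : Type*}

/-- Every vertex is contained in only finitely many simplices. -/
def IsLocallyFinite (K : AbstractSimplicialComplex V) : Prop :=
  ∀ v : V, {s : Finset V | s ∈ K ∧ v ∈ s}.Finite

/-- There is a bound `n` on the dimension (number of vertices minus one) of the simplices. -/
def IsFiniteDimensional (K : AbstractSimplicialComplex V) : Prop :=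
  ∃ n : ℕ, ∀ s : Finset V, s ∈ K → s.card ≤ n + 1

/-- The geometric realisation `‖K‖`: the points are given by barycentric coordinates, i.e.
finitely supported functions `V → ℝ` with nonnegative values summing to `1`, whose support is a
simplex of `K`. -/
def Realization (K : AbstractSimplicialComplex V) : Type _ :=
  {x : V →₀ ℝ // x.support ∈ K ∧ (∀ v, 0 ≤ x v) ∧ (x.sum fun _ a => a) = 1}

/-- The barycentric coordinates of a point. -/
def Realization.coord {K : AbstractSimplicialComplex V} (x : K.Realization) : V →₀ ℝ := x.1

/-- The closed simplex of `‖K‖` spanned by the vertices in `s`. -/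
def closedSimplex (K : AbstractSimplicialComplex V) (s : Finset V) : Set K.Realization :=
  {x | x.coord.support ⊆ s}

/-- The topology of a standard simplex on a closed simplex of `‖K‖`: barycentric coordinates
identify it with a subspace of a finite-dimensional real vector space. -/
@[reducible]
def simplexTopology (K : AbstractSimplicialComplex V) (s : Finset V) :
    TopologicalSpace (K.closedSimplex s) :=
  TopologicalSpace.induced (fun x (v : V) => x.1.coord v) inferInstance

/-- `‖K‖` carries the identification (weak) topology: a set is open iff its intersection with
every closed simplex is open in that simplex. -/
instance (K : AbstractSimplicialComplex V) : TopologicalSpace K.Realization :=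
  ⨆ s : {s : Finset V // s ∈ K},
    TopologicalSpace.coinduced (Subtype.val : K.closedSimplex s.1 → K.Realization)
      (K.simplexTopology s.1)

/-- The inclusion of `‖K‖` in `ℓ²(V)`, with the vertices going to the standard basis vectors.
On each closed simplex it is the standard embedding of that simplex in a Euclidean space. -/
def Realization.toL2 {K : AbstractSimplicialComplex V} (x : K.Realization) :
    lp (fun _ : V => ℝ) 2 :=
  ⟨fun v => x.coord v,
    (memℓp_zero (E := fun _ : V => ℝ) x.coord.hasFiniteSupport).of_exponent_ge (zero_le)⟩

/-- The length of a path in `‖K‖`, each simplex being given the Euclidean metric of its standard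
embedding. -/
def pathLength {K : AbstractSimplicialComplex V} {x y : K.Realization} (γ : Path x y) : ℝ≥0∞ :=
  eVariationOn (fun t : I => (γ t).toL2) Set.univ

/-- The standard metric on `‖K‖`: the path metric. It is infinite exactly between points that are
not joined by a path of finite length. -/
def standardDist (K : AbstractSimplicialComplex V) (x y : K.Realization) : ℝ≥0∞ :=
  ⨅ γ : Path x y, pathLength γ

open Classical in
/-- A simplicial map: a map of vertices that sends (the vertex set of) every simplex onto (the
vertex set of) a simplex, possibly of smaller dimension. -/
structure SimplicialMap (K : AbstractSimplicialComplex V) (L : AbstractSimplicialComplex W) where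
  toFun : V → W
  image_mem : ∀ s : Finset V, s ∈ K → s.image toFun ∈ L

namespace SimplicialMap

variable {K : AbstractSimplicialComplex V} {L : AbstractSimplicialComplex W}

/-- The simplexwise linear extension of a simplicial map, on points. -/
def mapPoint (f : SimplicialMap K L) (x : K.Realization) : L.Realization :=
  ⟨x.coord.mapDomain f.toFun, by
    classical
    obtain ⟨x, hx, h0, h1⟩ := x
    change (x.mapDomain f.toFun).support ∈ L ∧ (∀ w, 0 ≤ x.mapDomain f.toFun w) ∧
      ((x.mapDomain f.toFun).sum fun _ a => a) = 1
    have hsum : ((x.mapDomain f.toFun).sum fun _ a => a) = 1 := by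
      rw [Finsupp.sum_mapDomain_index (by simp) (by simp)]
      exact h1
    refine ⟨?_, ?_, hsum⟩
    · refine (L.isRelLowerSet_faces (f.image_mem _ hx)).2 ?_ ?_
      · convert (Finsupp.mapDomain_support : (x.mapDomain f.toFun).support ⊆ _)
      · rw [Finset.nonempty_iff_ne_empty]
        intro h
        rw [Finsupp.sum, h] at hsum
        simp at hsum
    · intro w
      rw [Finsupp.mapDomain, Finsupp.sum_apply]
      refine Finset.sum_nonneg fun v _ => ?_
      change 0 ≤ Finsupp.single (f.toFun v) (x v) w
      rw [Finsupp.single_apply]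
      split_ifs
      · exact h0 v
      · exact le_rfl⟩

theorem continuous_mapPoint (f : SimplicialMap K L) : Continuous f.mapPoint := by
  classical
  refine continuous_iSup_dom.2 fun s => continuous_coinduced_dom.2 ?_
  let _ := K.simplexTopology s.1
  let _ := L.simplexTopology (s.1.image f.toFun)
  have hmem (x : K.closedSimplex s.1) :
      f.mapPoint x.1 ∈ L.closedSimplex (s.1.image f.toFun) :=
    Finsupp.mapDomain_support.trans (Finset.image_subset_image x.2)
  have h1 : Continuous fun x : K.closedSimplex s.1 =>
      (⟨f.mapPoint x.1, hmem x⟩ : L.closedSimplex (s.1.image f.toFun)) := by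
    refine continuous_induced_rng.2 (continuous_pi fun w => ?_)
    have hv (v : V) : Continuous fun x : K.closedSimplex s.1 => x.1.coord v :=
      (continuous_apply v).comp
        (continuous_induced_dom (f := fun (x : K.closedSimplex s.1) (v : V) => x.1.coord v))
    have hcoord : (fun x : K.closedSimplex s.1 => (f.mapPoint x.1).coord w) =
        fun x => ∑ v ∈ s.1, if f.toFun v = w then x.1.coord v else 0 := by
      funext x
      change x.1.coord.mapDomain f.toFun w = _
      rw [Finsupp.mapDomain, Finsupp.sum_apply,
        Finsupp.sum_of_support_subset _ x.2 _ (by simp)]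
      exact Finset.sum_congr rfl fun v _ => Finsupp.single_apply
    change Continuous fun x : K.closedSimplex s.1 => (f.mapPoint x.1).coord w
    rw [hcoord]
    refine continuous_finsetSum _ fun v _ => ?_
    split_ifs
    · exact hv v
    · exact continuous_const
  have h2 : Continuous
      (Subtype.val : L.closedSimplex (s.1.image f.toFun) → L.Realization) :=
    continuous_iff_coinduced_le.2
      (le_iSup (fun t : {t : Finset W // t ∈ L} => TopologicalSpace.coinduced
        (Subtype.val : L.closedSimplex t.1 → L.Realization) (L.simplexTopology t.1))
        ⟨_, f.image_mem _ s.2⟩)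
  exact h2.comp h1

/-- The continuous map of geometric realisations given by a simplicial map. -/
def realize (f : SimplicialMap K L) : C(K.Realization, L.Realization) :=
  ⟨f.mapPoint, f.continuous_mapPoint⟩

end SimplicialMap

end AbstractSimplicialComplex

/-- All point inverses are contractible (in particular nonempty). -/
def HasContractiblePointInverses {A B : Type*} [TopologicalSpace A] [TopologicalSpace B]
    (f : C(A, B)) : Prop :=
  ∀ y : B, ContractibleSpace (f ⁻¹' {y})

/-! ## Controlled and bounded homotopy equivalences -/

section Control

variable {A B M : Type*} [TopologicalSpace A] [TopologicalSpace B]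

/-- A map `u : (A, p) → (B, q)` of sets with control maps to `(M, d)` has control `< ε`. -/
def IsControlled {A B : Type*} (d : M → M → ℝ≥0∞) (p : A → M) (q : B → M) (ε : ℝ≥0∞)
    (u : A → B) : Prop :=
  ∀ a, d (p a) (q (u a)) < ε

/-- `f : (A, p) → (B, q)` has a homotopy inverse `g` and homotopies `h₁ : g ∘ f ∼ id`,
`h₂ : f ∘ g ∼ id`, all of control `< ε` measured in `(M, d)`. A homotopy is a map from a product
with `[0, 1]`, the control map of the product being that of the space. -/
def HasControlledHomotopyInverse (d : M → M → ℝ≥0∞) (p : A → M) (q : B → M) (ε : ℝ≥0∞)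
    (f : C(A, B)) : Prop :=
  ∃ (g : C(B, A)) (h₁ : (g.comp f).Homotopy (ContinuousMap.id A))
    (h₂ : (f.comp g).Homotopy (ContinuousMap.id B)),
    IsControlled d q p ε g ∧
    IsControlled d (fun z : I × A => p z.2) p ε h₁ ∧
    IsControlled d (fun z : I × B => q z.2) q ε h₂

/-- `f : (A, p) → (B, q)` is an `ε`-controlled homotopy equivalence, measured in `(M, d)`: it
commutes with the control maps and it has an `ε`-controlled homotopy inverse. -/
def IsControlledHomotopyEquiv (d : M → M → ℝ≥0∞) (p : A → M) (q : B → M) (ε : ℝ≥0∞)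
    (f : C(A, B)) : Prop :=
  p = q ∘ f ∧ HasControlledHomotopyInverse d p q ε f

/-- `f : (A, p) → (B, q)` is a bounded homotopy equivalence, measured in `(M, d)`: the map, a
homotopy inverse and the two homotopies have a common finite bound. -/
def IsBoundedHomotopyEquiv (d : M → M → ℝ≥0∞) (p : A → M) (q : B → M) (f : C(A, B)) : Prop :=
  ∃ b : ℝ≥0∞, b < ∞ ∧ IsControlled d p q b f ∧ HasControlledHomotopyInverse d p q b f

end Control

/-! ## The open cone -/

/-- `(m, t) ∼ (m', t)` for all `m`, `m'` if `t ≤ 0`. -/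
def openConeSetoid (M : Type*) : Setoid (M × ℝ) where
  r a b := a.2 = b.2 ∧ (a.2 ≤ 0 ∨ a.1 = b.1)
  iseqv :=
    { refl := fun _ => ⟨rfl, Or.inr rfl⟩
      symm := by
        rintro a b ⟨h, h' | h'⟩
        · exact ⟨h.symm, Or.inl (h ▸ h')⟩
        · exact ⟨h.symm, Or.inr h'.symm⟩
      trans := by
        rintro a b c ⟨h, h'⟩ ⟨k, k'⟩
        refine ⟨h.trans k, ?_⟩
        rcases h' with h' | h'
        · exact Or.inl h'
        · rcases k' with k' | k'
          · exact Or.inl (h ▸ k')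
          · exact Or.inr (h'.trans k') }

/-- The open cone `O(M⁺)`, an identification space of `M × ℝ`. -/
def OpenCone (M : Type*) : Type _ := Quotient (openConeSetoid M)

namespace OpenCone

variable {M : Type*}

/-- The coning map `M × ℝ → O(M⁺)`. -/
def coningMap (M : Type*) : M × ℝ → OpenCone M := Quotient.mk (openConeSetoid M)

open Classical in
/-- The length of one piece of a path in the open cone: a geodesic at constant height `t` has
`max t 0` times its length in `M`, a vertical segment has its length in `ℝ`, and no other pieces
are allowed. -/
def pieceLength (d : M → M → ℝ≥0∞) (a b : M × ℝ) : ℝ≥0∞ :=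
  if a.2 = b.2 then ENNReal.ofReal a.2 * d a.1 b.1
  else if a.1 = b.1 then ENNReal.ofReal |a.2 - b.2|
  else ∞

/-- The path metric of the open cone on `(M, d)`: the infimum of the lengths of the paths made of
finitely many horizontal and vertical pieces (with corners `z 0`, …, `z n`). -/
def pathDist (d : M → M → ℝ≥0∞) (P Q : OpenCone M) : ℝ≥0∞ :=
  ⨅ (n : ℕ) (z : ℕ → M × ℝ) (_ : coningMap M (z 0) = P) (_ : coningMap M (z n) = Q),
    ∑ i ∈ Finset.range n, pieceLength d (z i) (z (i + 1))

/-- The expression `max (min t s) 0 * d m m' + |t - s|` on the open cone on `(M, d)`. It is the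
length of the path which runs horizontally at the lower of the two heights. -/
def formulaDist (d : M → M → ℝ≥0∞) : OpenCone M → OpenCone M → ℝ≥0∞ :=
  Quotient.lift₂
    (fun a b : M × ℝ =>
      ENNReal.ofReal (min a.2 b.2) * d a.1 b.1 + ENNReal.ofReal |a.2 - b.2|)
    (by
      rintro ⟨m, t⟩ ⟨n, s⟩ ⟨m', t'⟩ ⟨n', s'⟩ ⟨h, h'⟩ ⟨k, k'⟩
      dsimp only at h h' k k' ⊢
      subst h k
      have key : min t s ≤ 0 ∨ (m = m' ∧ n = n') := by
        rcases h' with h' | h'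
        · exact Or.inl ((min_le_left _ _).trans h')
        · rcases k' with k' | k'
          · exact Or.inl ((min_le_right _ _).trans k')
          · exact Or.inr ⟨h', k'⟩
      rcases key with key | ⟨rfl, rfl⟩
      · rw [ENNReal.ofReal_of_nonpos key, zero_mul, zero_mul]
      · rfl)

end OpenCone

end

/-! The key operation is `transport`: if the carrier of `y` lies in the carrier of `f x`, rescaling
the coordinates of `x` gives a point over `y`, continuously in both. So `f` is a product over each
open simplex, and a contraction of one fibre there contracts them all (`exists_isFibreContraction`).
Such contractions need not match across different simplices.

To pass from contractible fibres to controlled inverses, push `y` into its carrier with `truncate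
c`, which lowers the coordinates by `c`. The carrier of the truncation is locally constant away from
points with a coordinate equal to `c`, so at level `c` fibres can be contracted continuously if the
contraction is damped near those points. If simplices have at most `n + 1` vertices, then among `n +
2` separated levels one is far from all coordinates of `y`. Truncating and contracting at each level
in turn (`flow`) therefore ends at a point depending only on `f x` (`flow_one_eq`), which defines
the homotopy inverse. Over the base only truncation is visible (`realize_flow`), so the control is
of the order of the levels. Letting these shrink with the height `r` like `1 / (1 + |r|)`
compensates for the scaling of the cone (`exists_family_of_homotopyInverses`).

Conversely, a homotopy moving `y` by less than its least positive coordinate stays in the open star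
of its carrier, where `transport` pushes it back into the fibre over `y`
(`contractibleSpace_of_homotopy`). Bounded control in the cone gives such smallness at large height
(`mul_abs_sub_lt_of_pathDist_lt`). -/

noncomputable section

namespace AbstractSimplicialComplex

open Topology Filter Set

variable {V W : Type*} {K : AbstractSimplicialComplex V} {L : AbstractSimplicialComplex W}

/-! ### Barycentric coordinates and the topology of the realization. -/

namespace Realization

@[ext]
theorem ext {x y : K.Realization} (h : ∀ v, x.coord v = y.coord v) : x = y :=
  Subtype.ext (Finsupp.ext h)

theorem support_mem (x : K.Realization) : x.coord.support ∈ K := x.2.1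

theorem coord_nonneg (x : K.Realization) (v : V) : 0 ≤ x.coord v := x.2.2.1 v

theorem sum_coord (x : K.Realization) : ∑ v ∈ x.coord.support, x.coord v = 1 := x.2.2.2

theorem mem_support {x : K.Realization} {v : V} : v ∈ x.coord.support ↔ 0 < x.coord v := by
  rw [Finsupp.mem_support_iff]
  exact ⟨fun h => (x.coord_nonneg v).lt_of_ne' h, fun h => h.ne'⟩

theorem exists_mem_support (x : K.Realization) : ∃ v, v ∈ x.coord.support :=
  (K.isRelLowerSet_faces x.support_mem).1

/-- The point with given barycentric coordinates in the carrier of `x`. -/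
def ofCoord (x : K.Realization) (g : V → ℝ) (h0 : ∀ v, 0 ≤ g v) (hg : ∀ v, x.coord v = 0 → g v = 0)
    (h1 : ∑ v ∈ x.coord.support, g v = 1) : K.Realization :=
  ⟨Finsupp.onFinset x.coord.support g fun v hv => Finsupp.mem_support_iff.2 fun h => hv (hg v h), by
    have hsub : (Finsupp.onFinset x.coord.support g fun v hv =>
        Finsupp.mem_support_iff.2 fun h => hv (hg v h)).support ⊆ x.coord.support :=
      Finsupp.support_onFinset_subset
    have hsum : (Finsupp.onFinset x.coord.support g fun v hv =>
        Finsupp.mem_support_iff.2 fun h => hv (hg v h)).sum (fun _ a => a) = 1 := by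
      rw [Finsupp.sum_of_support_subset _ hsub _ (by simp)]
      exact h1
    refine ⟨(K.isRelLowerSet_faces x.support_mem).2 hsub ?_, h0, hsum⟩
    rw [Finset.nonempty_iff_ne_empty]
    intro h
    rw [Finsupp.sum, h] at hsum
    simp at hsum⟩

@[simp]
theorem coord_ofCoord (x : K.Realization) (g : V → ℝ) (h0 hg h1) (v : V) :
    (ofCoord x g h0 hg h1).coord v = g v := rfl

end Realization

open Realization

theorem continuous_coord (v : V) : Continuous fun x : K.Realization => x.coord v := by
  refine continuous_iSup_dom.2 fun s => continuous_coinduced_dom.2 ?_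
  let _ := K.simplexTopology s.1
  exact (continuous_apply v).comp
    (continuous_induced_dom (f := fun (x : K.closedSimplex s.1) (v : V) => x.1.coord v))

theorem isOpen_star (v : V) : IsOpen {x : K.Realization | v ∈ x.coord.support} := by
  simp only [mem_support]
  exact isOpen_lt continuous_const (continuous_coord v)

/-- In a locally finite complex, the points near a given point are carried by finitely many
vertices. -/
theorem IsLocallyFinite.exists_finset (hK : K.IsLocallyFinite) (x : K.Realization) :
    ∃ S : Finset V, ∀ᶠ y in 𝓝 x, y.coord.support ⊆ S := by
  classical
  obtain ⟨v, hv⟩ := x.exists_mem_support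
  refine ⟨(hK v).toFinset.biUnion id, ?_⟩
  filter_upwards [(isOpen_star v).mem_nhds hv] with y hy w hw
  exact Finset.mem_biUnion.2 ⟨_, (hK v).mem_toFinset.2 ⟨y.support_mem, hy⟩, hw⟩

theorem continuous_closedSimplex_val {s : Finset V} (hs : s ∈ K) :
    Continuous[K.simplexTopology s, _] (Subtype.val : K.closedSimplex s → K.Realization) :=
  continuous_iff_coinduced_le.2
    (le_iSup (fun t : {t : Finset V // t ∈ K} => TopologicalSpace.coinduced
      (Subtype.val : K.closedSimplex t.1 → K.Realization) (K.simplexTopology t.1)) ⟨s, hs⟩)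

theorem closedSimplex_eq_biInter (s : Finset V) :
    K.closedSimplex s = ⋂ v ∈ (s : Set V)ᶜ, {x | x.coord v = 0} := by
  ext x
  simp only [closedSimplex, mem_ofPred_eq, mem_iInter, mem_compl_iff, SetLike.mem_coe]
  exact ⟨fun h v hv => Finsupp.notMem_support_iff.1 fun h' => hv (h h'),
    fun h v hv => by_contra fun h' => Finsupp.mem_support_iff.1 hv (h v h')⟩

/-- The realization of a locally finite complex has the topology of pointwise convergence of
barycentric coordinates. -/
theorem IsLocallyFinite.isInducing_coord (hK : K.IsLocallyFinite) :
    IsInducing fun (x : K.Realization) (v : V) => x.coord v := by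
  refine ⟨le_antisymm (continuous_iff_le_induced.1 (continuous_pi continuous_coord)) ?_⟩
  set T : TopologicalSpace K.Realization :=
    TopologicalSpace.induced (fun (x : K.Realization) (v : V) => x.coord v) inferInstance with hT
  have hc (v : V) : Continuous[T, _] fun x : K.Realization => x.coord v :=
    (continuous_apply v).comp continuous_induced_dom
  -- `T` induces the simplex topology on each closed simplex, and closed simplices are `T`-closed.
  have key (s : Finset V) (hs : s ∈ K) (C : Set K.Realization)
      (hC : IsClosed[instTopologicalSpaceRealization K] C) : IsClosed[T] (C ∩ K.closedSimplex s) := by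
    have h2 : IsClosed[K.simplexTopology s] ((Subtype.val : K.closedSimplex s → _) ⁻¹' C) :=
      @IsClosed.preimage _ _ (K.simplexTopology s) (instTopologicalSpaceRealization K) _
        (continuous_closedSimplex_val hs) _ hC
    have h3 : K.simplexTopology s = @instTopologicalSpaceSubtype _ (· ∈ K.closedSimplex s) T := by
      rw [instTopologicalSpaceSubtype, hT, induced_compose]
      rfl
    have h4 : IsClosed[T] (K.closedSimplex s) := by
      rw [closedSimplex_eq_biInter]
      exact isClosed_biInter fun v _ => isClosed_eq (hc v) continuous_const
    rw [h3] at h2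
    have := (@IsClosed.isClosedEmbedding_subtypeVal _ T _ h4).isClosedMap _ h2
    rwa [Subtype.image_preimage_coe, inter_comm] at this
  intro U hU
  refine (isOpen_iff_mem_nhds).2 fun x hx => ?_
  obtain ⟨v, hv⟩ := x.exists_mem_support
  have h1 : IsOpen[T] {y : K.Realization | 0 < y.coord v} := isOpen_lt continuous_const (hc v)
  -- A finite intersection by local finiteness; on the star of `v` it avoids all of `Uᶜ`, since
  -- every carrier there contains `v`.
  have h2 : IsOpen[T] (⋂ s ∈ {s : Finset V | s ∈ K ∧ v ∈ s}, (Uᶜ ∩ K.closedSimplex s)ᶜ) :=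
    (hK v).isOpen_biInter fun s hs => (key s hs.1 _
      ((@isClosed_compl_iff _ (instTopologicalSpaceRealization K) _).2 hU)).isOpen_compl
  filter_upwards [h1.mem_nhds (mem_support.1 hv), h2.mem_nhds (mem_iInter₂.2 fun s _ h => h.1 hx)]
    with y hy hy'
  by_contra h
  exact mem_iInter₂.1 hy' y.coord.support ⟨y.support_mem, mem_support.2 hy⟩ ⟨h, Subset.rfl⟩

theorem IsLocallyFinite.tendsto_iff (hK : K.IsLocallyFinite) {A : Type*} {l : Filter A}
    {u : A → K.Realization} {x : K.Realization} :
    Tendsto u l (𝓝 x) ↔ ∀ v, Tendsto (fun a => (u a).coord v) l (𝓝 (x.coord v)) := by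
  rw [hK.isInducing_coord.tendsto_nhds_iff, tendsto_pi_nhds]
  rfl

theorem IsLocallyFinite.continuous_iff (hK : K.IsLocallyFinite) {A : Type*} [TopologicalSpace A]
    {u : A → K.Realization} : Continuous u ↔ ∀ v, Continuous fun a => (u a).coord v := by
  rw [hK.isInducing_coord.continuous_iff, continuous_pi_iff]
  rfl

/-- In a locally finite complex, sums over the vertices of continuous functions of the barycentric
coordinates that vanish at zero are continuous. -/
theorem IsLocallyFinite.continuous_sum (hK : K.IsLocallyFinite) {A : Type*} [TopologicalSpace A]
    {u : A → K.Realization} (hu : Continuous u) {g : A → ℝ → ℝ} (hg : Continuous ↿g)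
    (h0 : ∀ a, g a 0 = 0) :
    Continuous fun a => ∑ v ∈ (u a).coord.support, g a ((u a).coord v) := by
  refine continuous_iff_continuousAt.2 fun a => ?_
  obtain ⟨S, hS⟩ := hK.exists_finset (u a)
  have h1 : (fun a => ∑ v ∈ (u a).coord.support, g a ((u a).coord v)) =ᶠ[𝓝 a]
      fun a => ∑ v ∈ S, g a ((u a).coord v) := by
    filter_upwards [hu.continuousAt.eventually hS] with b hb
    refine Finset.sum_subset hb fun v _ hv => ?_
    rw [Finsupp.notMem_support_iff.1 hv, h0]
  refine ContinuousAt.congr (Continuous.continuousAt ?_) h1.symm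
  exact continuous_finsetSum _ fun v _ => hg.comp (continuous_id.prodMk ((continuous_coord v).comp hu))

/-! ### Straight line paths and the standard metric -/

/-- Coordinates are 1-Lipschitz on `ℓ²`, and a path is at least as long as its chord. -/
theorem abs_coord_sub_le_standardDist (x y : K.Realization) (v : V) :
    ENNReal.ofReal |x.coord v - y.coord v| ≤ K.standardDist x y := by
  refine le_iInf fun γ => ?_
  have h1 := eVariationOn.edist_le (fun t : I => (γ t).toL2) (mem_univ 0) (mem_univ 1)
  refine le_trans ?_ h1
  simp only [Path.source, Path.target]
  rw [edist_dist, dist_eq_norm]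
  refine ENNReal.ofReal_le_ofReal ?_
  exact lp.norm_apply_le_norm two_ne_zero (x.toL2 - y.toL2) v

theorem norm_toL2_sub_le (x y : K.Realization) (h : y.coord.support ⊆ x.coord.support) :
    ‖y.toL2 - x.toL2‖ ≤ ∑ v ∈ x.coord.support, |y.coord v - x.coord v| := by
  classical
  have : y.toL2 - x.toL2 = ∑ v ∈ x.coord.support,
      lp.single (E := fun _ : V => ℝ) 2 v (y.coord v - x.coord v) := by
    ext v
    simp only [lp.coeFn_sub, Pi.sub_apply, lp.coeFn_sum, Finset.sum_apply, lp.coeFn_single]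
    change y.coord v - x.coord v = _
    simp only [Pi.single_apply, Finset.sum_ite_eq]
    split_ifs with hv
    · rfl
    · rw [Finsupp.notMem_support_iff.1 hv, Finsupp.notMem_support_iff.1 fun h' => hv (h h'), sub_zero]
  rw [this]
  refine (norm_sum_le _ _).trans (Finset.sum_le_sum fun v _ => ?_)
  rw [lp.norm_single (by norm_num), Real.norm_eq_abs]

/-- The straight line from `x` to a point of its carrier. -/
def line (x y : K.Realization) (h : y.coord.support ⊆ x.coord.support) (t : I) : K.Realization :=
  ofCoord x (fun v => (1 - t) * x.coord v + t * y.coord v)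
    (fun v => add_nonneg (mul_nonneg (sub_nonneg.2 t.2.2) (x.coord_nonneg v))
      (mul_nonneg t.2.1 (y.coord_nonneg v)))
    (fun v hv => by
      rw [hv, Finsupp.notMem_support_iff.1 fun h' => Finsupp.mem_support_iff.1 (h h') hv]
      simp)
    (by
      have : ∑ v ∈ x.coord.support, y.coord v = 1 := by
        rw [← y.sum_coord]
        exact (Finset.sum_subset h fun v _ hv => Finsupp.notMem_support_iff.1 hv).symm
      rw [Finset.sum_add_distrib, ← Finset.mul_sum, ← Finset.mul_sum, x.sum_coord, this]
      ring)

/-- The segment stays in the carrier of `x`; its `ℓ²` length is at most its `ℓ¹` length. -/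
theorem IsLocallyFinite.standardDist_le (hK : K.IsLocallyFinite) (x y : K.Realization)
    (h : y.coord.support ⊆ x.coord.support) :
    K.standardDist x y ≤ ENNReal.ofReal (∑ v ∈ x.coord.support, |y.coord v - x.coord v|) := by
  let γ : Path x y :=
    { toFun := line x y h
      continuous_toFun := hK.continuous_iff.2 fun v => by
        simp only [line, coord_ofCoord]
        fun_prop
      source' := by ext v; simp [line]
      target' := by ext v; simp [line] }
  refine (iInf_le _ γ).trans ?_
  have h1 : (fun t : I => (γ t).toL2) =
      (fun t : ℝ => x.toL2 + t • (y.toL2 - x.toL2)) ∘ ((↑) : I → ℝ) := by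
    funext t
    ext v
    change (1 - (t : ℝ)) * x.coord v + t * y.coord v = x.coord v + t * (y.coord v - x.coord v)
    ring
  have h2 : LipschitzOnWith ‖y.toL2 - x.toL2‖₊ (fun t : ℝ => x.toL2 + t • (y.toL2 - x.toL2))
      univ := by
    refine LipschitzWith.lipschitzOnWith (LipschitzWith.of_dist_le_mul fun a b => ?_)
    rw [dist_add_left, dist_eq_norm, ← sub_smul, norm_smul, Real.dist_eq, coe_nnnorm, mul_comm,
      Real.norm_eq_abs]
  have h3 : eVariationOn ((↑) : I → ℝ) univ ≤ 1 := by
    have h := (Subtype.mono_coe (· ∈ I)).monotoneOn univ |>.eVariationOn_eq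
      (mem_univ (0 : I)) (mem_univ (1 : I))
    have h' : (univ : Set I) ∩ Icc 0 1 = univ := by
      ext t
      exact ⟨fun h => h.1, fun _ => ⟨trivial, t.2.1, t.2.2⟩⟩
    rw [h'] at h
    simp [h]
  rw [pathLength, h1]
  refine (h2.comp_eVariationOn_le (mapsTo_univ _ _)).trans ((mul_le_mul_right h3 _).trans ?_)
  rw [mul_one, ← enorm_eq_nnnorm, ← ofReal_norm]
  exact ENNReal.ofReal_le_ofReal (norm_toL2_sub_le x y h)

/-! ### Moving a point across the fibres of a simplicial map -/

namespace SimplicialMap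

theorem coord_realize [DecidableEq W] (f : SimplicialMap K L) (x : K.Realization) (w : W) :
    (f.realize x).coord w = ∑ v ∈ x.coord.support, if f.toFun v = w then x.coord v else 0 := by
  change x.coord.mapDomain f.toFun w = _
  rw [Finsupp.mapDomain, Finsupp.sum_apply, Finsupp.sum]
  exact Finset.sum_congr rfl fun v _ => Finsupp.single_apply

theorem coord_le_coord_realize (f : SimplicialMap K L) (x : K.Realization) (v : V) :
    x.coord v ≤ (f.realize x).coord (f.toFun v) := by
  classical
  by_cases hv : v ∈ x.coord.support
  · rw [coord_realize]
    refine le_trans (le_of_eq (if_pos rfl).symm)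
      (Finset.single_le_sum (f := fun v' => if f.toFun v' = f.toFun v then x.coord v' else 0)
        (fun v' _ => ?_) hv)
    split_ifs
    exacts [x.coord_nonneg _, le_rfl]
  · rw [Finsupp.notMem_support_iff.1 hv]
    exact coord_nonneg _ _

theorem coord_eq_zero_of_realize (f : SimplicialMap K L) {x : K.Realization} {v : V}
    (h : (f.realize x).coord (f.toFun v) = 0) : x.coord v = 0 :=
  le_antisymm (h ▸ f.coord_le_coord_realize x v) (x.coord_nonneg v)

/-- All vertices over `w` are scaled by the same factor, and their coordinates in `x` add up to that
of `f x` at `w`. By `h`, a zero denominator occurs only where `y` vanishes too. -/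
theorem sum_transport [DecidableEq W] (f : SimplicialMap K L) (x : K.Realization)
    (y : L.Realization) (h : y.coord.support ⊆ (f.realize x).coord.support) (w : W) :
    (∑ v ∈ x.coord.support, if f.toFun v = w then
      x.coord v * (y.coord (f.toFun v) / (f.realize x).coord (f.toFun v)) else 0) = y.coord w := by
  have h1 : ∀ v ∈ x.coord.support, (if f.toFun v = w then
      x.coord v * (y.coord (f.toFun v) / (f.realize x).coord (f.toFun v)) else 0) =
      (if f.toFun v = w then x.coord v else 0) * (y.coord w / (f.realize x).coord w) := by
    intro v _
    split_ifs with hv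
    · rw [hv]
    · rw [zero_mul]
  rw [Finset.sum_congr rfl h1, ← Finset.sum_mul, ← coord_realize]
  by_cases hw : (f.realize x).coord w = 0
  · rw [hw, zero_mul, Finsupp.notMem_support_iff.1 fun h' => Finsupp.mem_support_iff.1 (h h') hw]
  · rw [mul_div_cancel₀ _ hw]

open Classical in
/-- The point over `y` obtained from `x` by rescaling its barycentric coordinates, provided that
`y` is in the carrier of the image of `x`. -/
def transport (f : SimplicialMap K L) (x : K.Realization) (y : L.Realization) : K.Realization :=
  if h : y.coord.support ⊆ (f.realize x).coord.support then
    ofCoord x (fun v => x.coord v * (y.coord (f.toFun v) / (f.realize x).coord (f.toFun v)))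
      (fun v => mul_nonneg (x.coord_nonneg v) (div_nonneg (coord_nonneg _ _) (coord_nonneg _ _)))
      (fun v hv => by rw [hv, zero_mul])
      (by
        rw [← y.sum_coord, ← Finset.sum_congr rfl fun w _ => f.sum_transport x y h w,
          Finset.sum_comm]
        refine Finset.sum_congr rfl fun v _ => ?_
        rw [Finset.sum_ite_eq]
        split_ifs with hv
        · rfl
        · rw [Finsupp.notMem_support_iff.1 hv, zero_div, mul_zero])
  else x

section

variable (f : SimplicialMap K L) {x : K.Realization} {y z : L.Realization}

theorem coord_transport (h : y.coord.support ⊆ (f.realize x).coord.support) (v : V) :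
    (f.transport x y).coord v =
      x.coord v * (y.coord (f.toFun v) / (f.realize x).coord (f.toFun v)) := by
  rw [transport, dif_pos h]
  rfl

theorem realize_transport (h : y.coord.support ⊆ (f.realize x).coord.support) :
    f.realize (f.transport x y) = y := by
  classical
  ext w
  rw [← f.sum_transport x y h w, coord_realize]
  have hsub : (f.transport x y).coord.support ⊆ x.coord.support := by
    intro v hv
    rw [Finsupp.mem_support_iff, coord_transport f h] at hv
    exact Finsupp.mem_support_iff.2 (left_ne_zero_of_mul hv)
  rw [Finset.sum_subset hsub fun v _ hv => by
    rw [Finsupp.notMem_support_iff.1 hv, ite_self]]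
  simp only [coord_transport f h]

theorem transport_self : f.transport x (f.realize x) = x := by
  ext v
  rw [coord_transport f Subset.rfl]
  by_cases hv : (f.realize x).coord (f.toFun v) = 0
  · rw [f.coord_eq_zero_of_realize hv, zero_mul]
  · rw [div_self hv, mul_one]

theorem transport_transport (h : y.coord.support ⊆ (f.realize x).coord.support)
    (h' : z.coord.support ⊆ y.coord.support) :
    f.transport (f.transport x y) z = f.transport x z := by
  ext v
  rw [coord_transport f (by rwa [realize_transport f h]), coord_transport f h,
    coord_transport f (h'.trans h), realize_transport f h]
  by_cases hv : y.coord (f.toFun v) = 0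
  · rw [hv, Finsupp.notMem_support_iff.1 fun h₂ => Finsupp.mem_support_iff.1 (h' h₂) hv]
    simp
  · rw [mul_assoc, div_mul_div_comm, mul_comm (y.coord _), mul_div_mul_right _ _ hv]

/-- The quotient is singular where the coordinate of `f x` vanishes, but `coord_le_coord_realize`
bounds the whole product by the coordinate of `y`, which tends to `0` there. -/
theorem continuousOn_transport (hK : K.IsLocallyFinite) :
    ContinuousOn (fun p : K.Realization × L.Realization => f.transport p.1 p.2)
      {p | p.2.coord.support ⊆ (f.realize p.1).coord.support} := by
  intro p hp
  refine hK.tendsto_iff.2 fun v => ?_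
  have hc : ∀ᶠ q in 𝓝[{p | p.2.coord.support ⊆ (f.realize p.1).coord.support}] p,
      q.1.coord v * (q.2.coord (f.toFun v) / (f.realize q.1).coord (f.toFun v)) =
        (f.transport q.1 q.2).coord v :=
    eventually_mem_nhdsWithin.mono fun q hq => (coord_transport f hq v).symm
  refine Tendsto.congr' hc ?_
  rw [coord_transport f hp]
  have c1 : Continuous fun q : K.Realization × L.Realization => q.1.coord v :=
    (continuous_coord v).comp continuous_fst
  have c2 : Continuous fun q : K.Realization × L.Realization => q.2.coord (f.toFun v) :=
    (continuous_coord _).comp continuous_snd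
  have c3 : Continuous fun q : K.Realization × L.Realization =>
      (f.realize q.1).coord (f.toFun v) :=
    (continuous_coord _).comp (f.realize.continuous.comp continuous_fst)
  by_cases hv : (f.realize p.1).coord (f.toFun v) = 0
  · have h2 : p.2.coord (f.toFun v) = 0 :=
      Finsupp.notMem_support_iff.1 fun h' => Finsupp.mem_support_iff.1 (hp h') hv
    rw [h2, zero_div, mul_zero]
    have h3 := c2.tendsto p
    rw [h2] at h3
    refine squeeze_zero (fun q => mul_nonneg (coord_nonneg _ _)
      (div_nonneg (coord_nonneg _ _) (coord_nonneg _ _))) (fun q => ?_)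
      (h3.mono_left nhdsWithin_le_nhds)
    rw [mul_div_assoc', mul_comm, mul_div_assoc]
    exact mul_le_of_le_one_right (coord_nonneg _ _)
      (div_le_one_of_le₀ (f.coord_le_coord_realize _ _) (coord_nonneg _ _))
  · exact (c1.continuousAt.mul (c2.continuousAt.div c3.continuousAt hv)).tendsto.mono_left
      nhdsWithin_le_nhds

theorem continuous_transport (hK : K.IsLocallyFinite) {A : Type*} [TopologicalSpace A]
    {u : A → K.Realization} {v : A → L.Realization} (hu : Continuous u) (hv : Continuous v)
    (h : ∀ a, (v a).coord.support ⊆ (f.realize (u a)).coord.support) :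
    Continuous fun a => f.transport (u a) (v a) :=
  (f.continuousOn_transport hK).comp_continuous (hu.prodMk hv) h

end

end SimplicialMap

/-! ### Truncation of barycentric coordinates -/

theorem exists_lt_coord {n : ℕ} (hn : ∀ s : Finset V, s ∈ K → s.card ≤ n + 1) (x : K.Realization)
    {c : ℝ} (hc : (n + 1) * c < 1) : ∃ v ∈ x.coord.support, c < x.coord v := by
  by_contra! h
  have h1 := Finset.sum_le_card_nsmul _ _ _ h
  rw [x.sum_coord, nsmul_eq_mul] at h1
  have h2 : (x.coord.support.card : ℝ) ≤ n + 1 := by exact_mod_cast hn _ x.support_mem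
  rcases le_total 0 c with hc0 | hc0
  · nlinarith
  · nlinarith [Nat.cast_nonneg (α := ℝ) x.coord.support.card]

/-- The total mass of the barycentric coordinates after `c` is subtracted. -/
def excess (c : ℝ) (x : K.Realization) : ℝ := ∑ v ∈ x.coord.support, max (x.coord v - c) 0

theorem excess_pos {c : ℝ} {x : K.Realization} (h : ∃ v ∈ x.coord.support, c < x.coord v) :
    0 < excess c x := by
  obtain ⟨v, hv, hc⟩ := h
  exact Finset.sum_pos' (fun _ _ => le_max_right _ _) ⟨v, hv, lt_max_of_lt_left (sub_pos.2 hc)⟩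

open Classical in
/-- Subtract `c` from all barycentric coordinates, as far as they are greater than `c`, and
normalize. -/
def truncate (c : ℝ) (x : K.Realization) : K.Realization :=
  if h : 0 ≤ c ∧ 0 < excess c x then
    ofCoord x (fun v => max (x.coord v - c) 0 / excess c x)
      (fun _ => div_nonneg (le_max_right _ _) h.2.le)
      (fun v hv => by rw [hv, max_eq_right (by linarith [h.1]), zero_div])
      (by rw [← Finset.sum_div]; exact div_self h.2.ne')
  else x

theorem coord_truncate {c : ℝ} {x : K.Realization} (hc : 0 ≤ c)
    (h : ∃ v ∈ x.coord.support, c < x.coord v) (v : V) :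
    (truncate c x).coord v = max (x.coord v - c) 0 / excess c x := by
  rw [truncate, dif_pos ⟨hc, excess_pos h⟩]
  rfl

theorem mem_support_truncate {c : ℝ} {x : K.Realization} (hc : 0 ≤ c)
    (h : ∃ v ∈ x.coord.support, c < x.coord v) {v : V} :
    v ∈ (truncate c x).coord.support ↔ c < x.coord v := by
  rw [mem_support, coord_truncate hc h, div_pos_iff_of_pos_right (excess_pos h), lt_max_iff,
    sub_pos]
  simp

theorem truncate_zero (x : K.Realization) : truncate 0 x = x := by
  obtain ⟨v, hv⟩ := x.exists_mem_support
  have h1 : excess 0 x = 1 := by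
    rw [← x.sum_coord]
    exact Finset.sum_congr rfl fun v _ => by rw [sub_zero, max_eq_left (x.coord_nonneg v)]
  ext v
  rw [coord_truncate le_rfl ⟨_, hv, mem_support.1 hv⟩, h1, sub_zero, div_one,
    max_eq_left (x.coord_nonneg v)]

theorem IsLocallyFinite.continuous_truncate (hK : K.IsLocallyFinite) {A : Type*}
    [TopologicalSpace A] {u : A → K.Realization} {c : A → ℝ} (hu : Continuous u)
    (hc : Continuous c) (h0 : ∀ a, 0 ≤ c a)
    (h : ∀ a, ∃ v ∈ (u a).coord.support, c a < (u a).coord v) :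
    Continuous fun a => truncate (c a) (u a) := by
  refine hK.continuous_iff.2 fun v => ?_
  simp only [coord_truncate (h0 _) (h _)]
  refine Continuous.div ((((continuous_coord v).comp hu).sub hc).max continuous_const) ?_
    fun a => (excess_pos (h a)).ne'
  have := hK.continuous_sum hu (g := fun a t => max (t - c a) (max (-c a) 0)) (by
    change Continuous fun p : A × ℝ => max (p.2 - c p.1) (max (-c p.1) 0)
    fun_prop) (fun a => by simp [h0 a])
  refine this.congr fun a => ?_
  simp [excess, h0 a]

/-- Subtracting `c` removes mass `1 - excess c x ≤ (n + 1) * c`, and normalizing puts the same mass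
back; hence the factor `2`. -/
theorem IsLocallyFinite.standardDist_truncate_le (hK : K.IsLocallyFinite) {n : ℕ}
    (hn : ∀ s : Finset V, s ∈ K → s.card ≤ n + 1) (x : K.Realization) {c : ℝ} (hc : 0 ≤ c)
    (hc1 : (n + 1) * c < 1) :
    K.standardDist x (truncate c x) ≤ ENNReal.ofReal (2 * (n + 1) * c) := by
  have h := exists_lt_coord hn x hc1
  have hsub : (truncate c x).coord.support ⊆ x.coord.support := fun v hv =>
    mem_support.2 (hc.trans_lt ((mem_support_truncate hc h).1 hv))
  refine (hK.standardDist_le x _ hsub).trans (ENNReal.ofReal_le_ofReal ?_)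
  have hZ := excess_pos h
  have hcard : (x.coord.support.card : ℝ) ≤ n + 1 := by exact_mod_cast hn _ x.support_mem
  have h1 : 1 - excess c x ≤ (n + 1) * c := by
    have h2 : 1 - excess c x = ∑ v ∈ x.coord.support, (x.coord v - max (x.coord v - c) 0) := by
      rw [Finset.sum_sub_distrib, x.sum_coord, excess]
    rw [h2]
    refine (Finset.sum_le_card_nsmul _ _ c fun v _ => ?_).trans ?_
    · linarith [le_max_left (x.coord v - c) 0]
    · rw [nsmul_eq_mul]
      exact mul_le_mul_of_nonneg_right hcard hc
  have h2 : excess c x ≤ 1 := by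
    rw [← x.sum_coord]
    exact Finset.sum_le_sum fun v _ => max_le (by linarith) (x.coord_nonneg v)
  have h3 : ∀ v ∈ x.coord.support, |(truncate c x).coord v - x.coord v| ≤
      (max (x.coord v - c) 0 / excess c x - max (x.coord v - c) 0) +
        (x.coord v - max (x.coord v - c) 0) := by
    intro v _
    rw [coord_truncate hc h]
    have e1 : max (x.coord v - c) 0 ≤ max (x.coord v - c) 0 / excess c x :=
      le_div_self (le_max_right _ _) hZ h2
    have e2 : max (x.coord v - c) 0 ≤ x.coord v := max_le (by linarith) (x.coord_nonneg v)
    rw [abs_le]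
    constructor <;> linarith
  refine (Finset.sum_le_sum h3).trans ?_
  rw [Finset.sum_add_distrib, Finset.sum_sub_distrib, Finset.sum_sub_distrib, ← Finset.sum_div,
    x.sum_coord]
  change excess c x / excess c x - excess c x + (1 - excess c x) ≤ _
  rw [div_self hZ.ne']
  linarith

theorem support_truncate_subset {c c' : ℝ} {x : K.Realization} (hc : 0 ≤ c) (hcc : c ≤ c')
    (h : ∃ v ∈ x.coord.support, c' < x.coord v) :
    (truncate c' x).coord.support ⊆ (truncate c x).coord.support := by
  intro v hv
  have h' : ∃ v ∈ x.coord.support, c < x.coord v := h.imp fun v hv => ⟨hv.1, hcc.trans_lt hv.2⟩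
  rw [mem_support_truncate (hc.trans hcc) h] at hv
  exact (mem_support_truncate hc h').2 (hcc.trans_lt hv)

/-- The vertices of the carrier of a truncation do not change where no coordinate passes the
truncation level. -/
theorem IsLocallyFinite.eventually_support_truncate_eq (hK : K.IsLocallyFinite) {A : Type*}
    [TopologicalSpace A] {u : A → K.Realization} {c : A → ℝ} (hu : Continuous u)
    (hc : Continuous c) (h0 : ∀ a, 0 < c a)
    (h : ∀ a, ∃ v ∈ (u a).coord.support, c a < (u a).coord v) {a : A}
    (ha : ∀ v ∈ (u a).coord.support, (u a).coord v ≠ c a) :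
    ∀ᶠ b in 𝓝 a, (truncate (c b) (u b)).coord.support = (truncate (c a) (u a)).coord.support := by
  obtain ⟨S, hS⟩ := hK.exists_finset (u a)
  have h1 : ∀ᶠ b in 𝓝 a, ∀ v ∈ S, (c b < (u b).coord v ↔ c a < (u a).coord v) := by
    refine (eventually_all_finset S).2 fun v _ => ?_
    have hv : Continuous fun b => (u b).coord v := (continuous_coord v).comp hu
    rcases lt_trichotomy (c a) ((u a).coord v) with hlt | heq | hgt
    · filter_upwards [hc.continuousAt.eventually_lt hv.continuousAt hlt] with b hb
      exact iff_of_true hb hlt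
    · by_cases hs : v ∈ (u a).coord.support
      · exact absurd heq.symm (ha v hs)
      · rw [Finsupp.notMem_support_iff.1 hs] at heq
        exact absurd heq (h0 a).ne'
    · filter_upwards [hv.continuousAt.eventually_lt hc.continuousAt hgt] with b hb
      exact iff_of_false hb.not_gt hgt.not_gt
  filter_upwards [h1, hu.continuousAt.eventually hS] with b hb hb'
  ext v
  rw [mem_support_truncate (h0 _).le (h _), mem_support_truncate (h0 _).le (h _)]
  by_cases hv : v ∈ S
  · exact hb v hv
  · have e1 := Finsupp.notMem_support_iff.1 fun h' => hv (hb' h')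
    have e2 := Finsupp.notMem_support_iff.1 fun h' => hv (hS.self_of_nhds h')
    rw [e1, e2]
    exact iff_of_false (h0 _).le.not_gt (h0 _).le.not_gt

/-! ### Simultaneous contraction of the fibres over an open simplex. -/

namespace SimplicialMap

/-- A contraction, for every `s`, of the point inverses over the open simplex on `s`. It starts
at time `0` and is finished at time `1`. -/
structure IsFibreContraction (f : SimplicialMap K L)
    (k : Finset W → K.Realization × ℝ → K.Realization) : Prop where
  continuousOn (s) : ContinuousOn (k s) {p | (f.realize p.1).coord.support = s}
  realize_eq (s x a) : (f.realize x).coord.support = s → f.realize (k s (x, a)) = f.realize x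
  eq_self (s x) : (f.realize x).coord.support = s → k s (x, 0) = x
  eq_of_eq (s x x') : (f.realize x).coord.support = s → f.realize x' = f.realize x →
    k s (x, 1) = k s (x', 1)

theorem exists_isFibreContraction (f : SimplicialMap K L) (hK : K.IsLocallyFinite)
    (hf : HasContractiblePointInverses f.realize) : ∃ k, f.IsFibreContraction k := by
  classical
  have key (s : Finset W) : ∃ k : K.Realization × ℝ → K.Realization,
      ContinuousOn k {p | (f.realize p.1).coord.support = s} ∧
      (∀ x a, (f.realize x).coord.support = s → f.realize (k (x, a)) = f.realize x) ∧
      (∀ x, (f.realize x).coord.support = s → k (x, 0) = x) ∧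
      ∀ x x', (f.realize x).coord.support = s → f.realize x' = f.realize x →
        k (x, 1) = k (x', 1) := by
    by_cases hs : ∃ b : L.Realization, b.coord.support = s
    · obtain ⟨b, rfl⟩ := hs
      have := hf b
      obtain ⟨p, ⟨H⟩⟩ := id_nullhomotopic (f.realize ⁻¹' {b})
      have hsub (x) (hx : (f.realize x).coord.support = b.coord.support) :
          b.coord.support ⊆ (f.realize x).coord.support := hx.ge
      let q (z : {p : K.Realization × ℝ | (f.realize p.1).coord.support = b.coord.support}) :
          f.realize ⁻¹' {b} :=
        ⟨f.transport z.1.1 b, f.realize_transport (hsub _ z.2)⟩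
      -- Move to the fibre over the base point `b`, contract there, and move back; `projIcc` clamps
      -- real times to `[0, 1]`.
      let k (z : {p : K.Realization × ℝ | (f.realize p.1).coord.support = b.coord.support}) :
          K.Realization :=
        f.transport (H (projIcc 0 1 zero_le_one z.1.2, q z)).1 (f.realize z.1.1)
      have hH (z) : f.realize (H z).1 = b := (H z).2
      have hk (z) : (f.realize z.1.1).coord.support ⊆
          (f.realize (H (projIcc 0 1 zero_le_one z.1.2, q z)).1).coord.support := by
        rw [hH]
        exact z.2.le
      refine ⟨fun p => if h : (f.realize p.1).coord.support = b.coord.support then k ⟨p, h⟩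
        else p.1, ?_, ?_, ?_, ?_⟩
      · rw [continuousOn_iff_continuous_domRestrict]
        have hkc : Continuous k := by
          have hq : Continuous q := Continuous.subtype_mk
            (f.continuous_transport hK (continuous_fst.comp continuous_subtype_val)
              continuous_const fun z => hsub _ z.2) _
          refine f.continuous_transport hK ?_ ?_ hk
          · exact continuous_subtype_val.comp (H.continuous.comp
              ((continuous_projIcc.comp (continuous_snd.comp continuous_subtype_val)).prodMk hq))
          · exact f.realize.continuous.comp (continuous_fst.comp continuous_subtype_val)
        exact hkc.congr fun z => (dif_pos (t := fun h => k ⟨z.1, h⟩) (e := fun _ => z.1.1)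
          (show (f.realize z.1.1).coord.support = b.coord.support from z.2)).symm
      · intro x a hx
        simp only [dif_pos hx]
        exact f.realize_transport (hk ⟨(x, a), hx⟩)
      · intro x hx
        simp only [dif_pos hx, k, projIcc_left, Icc.mk_zero]
        rw [H.apply_zero, ContinuousMap.id_apply, f.transport_transport (hsub x hx) hx.le,
          f.transport_self]
      · intro x x' hx hxx
        have hx' : (f.realize x').coord.support = b.coord.support := by rw [hxx, hx]
        simp only [dif_pos hx, dif_pos hx', k, projIcc_right, Icc.mk_one]
        rw [H.apply_one, H.apply_one]
        exact congrArg (f.transport p.1) hxx.symm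
    -- No point has carrier `s`, so all conditions are vacuous.
    · have hs' (x) : (f.realize x).coord.support ≠ s := fun h => hs ⟨_, h⟩
      exact ⟨Prod.fst, continuous_fst.continuousOn, fun x a h => (hs' x h).elim,
        fun x h => (hs' x h).elim, fun x _ h => (hs' x h).elim⟩
  choose k h1 h2 h3 h4 using key
  exact ⟨k, h1, h2, h3, h4⟩

/-- This vanishes if all coordinates have distance at least `η` from `c`, and is at least `1` if
one of them is `c`. -/
def _root_.AbstractSimplicialComplex.crowding (η c : ℝ) (y : L.Realization) : ℝ :=
  ∑ w ∈ y.coord.support, max (1 - |y.coord w - c| / η) 0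

theorem _root_.AbstractSimplicialComplex.ne_of_crowding_lt_one {η c : ℝ} {y : L.Realization}
    (h : crowding η c y < 1) : ∀ w ∈ y.coord.support, y.coord w ≠ c := by
  intro w hw hc
  have := Finset.single_le_sum (f := fun w => max (1 - |y.coord w - c| / η) 0)
    (fun w _ => le_max_right _ _) hw
  simp only [hc, sub_self, abs_zero, zero_div, sub_zero, max_eq_left zero_le_one] at this
  exact (this.trans_lt h).false

/-- Pigeonhole: the `n + 2` levels are `2 * η` apart, so each of the at most `n + 1` coordinates is
within `η` of at most one of them. -/
theorem _root_.AbstractSimplicialComplex.exists_crowding_eq_zero {n : ℕ}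
    (hn : ∀ s : Finset W, s ∈ L → s.card ≤ n + 1) (y : L.Realization) {η : ℝ} (hη : 0 < η) :
    ∃ i < n + 2, crowding η (2 * (i + 1 : ℕ) * η) y = 0 := by
  by_contra! h
  have h1 : ∀ i : Fin (n + 2), ∃ w ∈ y.coord.support,
      |y.coord w - 2 * ((i : ℕ) + 1 : ℕ) * η| < η := by
    intro i
    by_contra! h'
    refine h i i.2 (Finset.sum_eq_zero fun w hw => max_eq_right ?_)
    rw [sub_nonpos, one_le_div hη]
    exact h' w hw
  choose w hw hwi using h1
  have hinj : Function.Injective w := by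
    intro i j hij
    have a1 := abs_lt.1 (hwi i)
    have a2 := abs_lt.1 (hwi j)
    rw [hij] at a1
    push_cast at a1 a2
    have b1 : ((i : ℕ) : ℝ) < (j : ℕ) + 1 := by
      by_contra! hc
      nlinarith [mul_le_mul_of_nonneg_right hc hη.le]
    have b2 : ((j : ℕ) : ℝ) < (i : ℕ) + 1 := by
      by_contra! hc
      nlinarith [mul_le_mul_of_nonneg_right hc hη.le]
    norm_cast at b1 b2
    exact Fin.ext (by omega)
  have h2 := Finset.card_le_card_of_injOn (s := Finset.univ) w (fun i _ => hw i) hinj.injOn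
  have h3 := hn _ y.support_mem
  rw [Finset.card_univ, Fintype.card_fin] at h2
  omega

/-! ### Successive truncation and damped contraction. -/

section Flow

variable (f : SimplicialMap K L) (k : Finset W → K.Realization × ℝ → K.Realization) (η : ℝ → ℝ)

/-- Truncate the image of a point in `L` at the levels `2 * η`, `4 * η`, … successively, and
contract in the point inverses at those levels which are not near to any barycentric coordinate. -/
def flow : ℕ → K.Realization × ℝ × ℝ → K.Realization
  | 0, p => p.1
  | i + 1, p =>
    k (truncate (2 * (i + 1 : ℕ) * η p.2.1) (f.realize p.1)).coord.support
      (f.transport (flow i p) (truncate (2 * (i + 1 : ℕ) * η p.2.1) (f.realize p.1)),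
        p.2.2 * max (1 - 2 * crowding (η p.2.1) (2 * (i + 1 : ℕ) * η p.2.1) (f.realize p.1)) 0)

variable {f k η} {n : ℕ}

section

variable (hn : ∀ s : Finset W, s ∈ L → s.card ≤ n + 1) (h0 : ∀ r, 0 < η r)
  (h1 : ∀ r, (n + 1) * (2 * (n + 2) * η r) < 1)

include hn h0 h1

theorem exists_level_lt {i : ℕ} (hi : i ≤ n + 2) (r : ℝ) (y : L.Realization) :
    ∃ w ∈ y.coord.support, 2 * i * η r < y.coord w := by
  refine exists_lt_coord hn y (lt_of_le_of_lt ?_ (h1 r))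
  have : (i : ℝ) ≤ n + 2 := by exact_mod_cast hi
  have := (h0 r).le
  gcongr

theorem level_support_subset {i : ℕ} (hi : i + 1 ≤ n + 2) (r : ℝ) (y : L.Realization) :
    (truncate (2 * (i + 1 : ℕ) * η r) y).coord.support ⊆
      (truncate (2 * i * η r) y).coord.support := by
  have := (h0 r).le
  refine support_truncate_subset (by positivity) ?_ (exists_level_lt hn h0 h1 hi r y)
  gcongr
  exact i.le_succ

variable (hk : f.IsFibreContraction k)

include hk

/-- The contractions preserve fibres, so only the last transport is seen in `L`. -/
theorem realize_flow {i : ℕ} (hi : i ≤ n + 2) (p : K.Realization × ℝ × ℝ) :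
    f.realize (flow f k η i p) = truncate (2 * i * η p.2.1) (f.realize p.1) := by
  induction i with
  | zero => simp [flow, truncate_zero]
  | succ i ih =>
    have h := f.realize_transport (x := flow f k η i p)
      (y := truncate (2 * (i + 1 : ℕ) * η p.2.1) (f.realize p.1)) (by
        rw [ih (by omega)]
        exact level_support_subset hn h0 h1 hi _ _)
    rw [flow, hk.realize_eq _ _ _ (by rw [h]), h]

theorem level_support_subset_flow {i : ℕ} (hi : i + 1 ≤ n + 2) (p : K.Realization × ℝ × ℝ) :
    (truncate (2 * (i + 1 : ℕ) * η p.2.1) (f.realize p.1)).coord.support ⊆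
      (f.realize (flow f k η i p)).coord.support := by
  rw [realize_flow hn h0 h1 hk (by omega)]
  exact level_support_subset hn h0 h1 hi _ _

/-- At time `0` no contraction acts, and the transports compose to a single one. -/
theorem flow_zero {i : ℕ} (hi : i ≤ n + 2) (x : K.Realization) (r : ℝ) :
    flow f k η i (x, r, 0) = f.transport x (truncate (2 * i * η r) (f.realize x)) := by
  induction i with
  | zero => simp [flow, truncate_zero, transport_self]
  | succ i ih =>
    have hs := level_support_subset_flow hn h0 h1 hk hi (x, r, 0)
    have hr := (h0 r).le
    rw [flow, zero_mul, hk.eq_self _ _ (by rw [f.realize_transport hs]), ih (by omega),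
      f.transport_transport _ (level_support_subset hn h0 h1 hi _ _)]
    have := support_truncate_subset (c' := 2 * i * η r) le_rfl (by positivity)
      (exists_level_lt hn h0 h1 (by omega : i ≤ n + 2) r (f.realize x))
    rwa [truncate_zero] at this

/-- At a level with zero crowding the contraction runs to its end and forgets everything but `f x`;
later steps use no other information about `x`. -/
theorem flow_one_eq {x x' : K.Realization} (hx : f.realize x = f.realize x') (r : ℝ) :
    flow f k η (n + 2) (x, r, 1) = flow f k η (n + 2) (x', r, 1) := by
  obtain ⟨i, hi, hcr⟩ := exists_crowding_eq_zero hn (f.realize x') (h0 r)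
  have hj : i + 1 ≤ n + 2 := hi
  suffices ∀ j, i + 1 ≤ j → j ≤ n + 2 → flow f k η j (x, r, 1) = flow f k η j (x', r, 1) from
    this _ hj le_rfl
  intro j hij
  induction j, hij using Nat.le_induction with
  | base =>
    intro _
    have hs := level_support_subset_flow hn h0 h1 hk hi (x, r, 1)
    have hs' := level_support_subset_flow hn h0 h1 hk hi (x', r, 1)
    have e := f.realize_transport hs
    have e' := f.realize_transport hs'
    simp only [hx] at e
    rw [flow, flow]
    simp only [hx, hcr, mul_zero, sub_zero, max_eq_left zero_le_one, mul_one]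
    exact hk.eq_of_eq _ _ _ (by rw [e]) (by rw [e, e'])
  | succ j hij ih =>
    intro hj
    rw [flow, flow, ih (by omega)]
    simp only [hx]

/-- Two overlapping regions cover everything. Where the crowding is below `1`, the carrier of the
truncation is locally constant and a single `k s` acts; where it exceeds `1 / 2`, the damped time is
`0` and only the transport remains. -/
theorem continuous_flow (hK : K.IsLocallyFinite) (hL : L.IsLocallyFinite) (hη : Continuous η)
    {i : ℕ} (hi : i ≤ n + 2) : Continuous (flow f k η i) := by
  induction i with
  | zero => exact continuous_fst
  | succ i ih =>
    have cc : Continuous fun p : K.Realization × ℝ × ℝ => 2 * (i + 1 : ℕ) * η p.2.1 := by fun_prop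
    have cf : Continuous fun p : K.Realization × ℝ × ℝ => f.realize p.1 := by fun_prop
    have hc0 (p : K.Realization × ℝ × ℝ) : 0 < 2 * (i + 1 : ℕ) * η p.2.1 := by
      have := h0 p.2.1
      positivity
    have hex (p : K.Realization × ℝ × ℝ) := exists_level_lt hn h0 h1 hi p.2.1 (f.realize p.1)
    have cy := hL.continuous_truncate cf cc (fun p => (hc0 p).le) hex
    have hs := level_support_subset_flow hn h0 h1 hk hi
    have cx := f.continuous_transport hK (ih (by omega)) cy hs
    have cθ : Continuous fun p : K.Realization × ℝ × ℝ =>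
        crowding (η p.2.1) (2 * (i + 1 : ℕ) * η p.2.1) (f.realize p.1) := by
      refine hL.continuous_sum cf
        (g := fun p t => max (1 - |t - 2 * (i + 1 : ℕ) * η p.2.1| / η p.2.1) 0) ?_ fun p => ?_
      · change Continuous fun q : (K.Realization × ℝ × ℝ) × ℝ =>
          max (1 - |q.2 - 2 * (i + 1 : ℕ) * η q.1.2.1| / η q.1.2.1) 0
        have cη : Continuous fun q : (K.Realization × ℝ × ℝ) × ℝ => η q.1.2.1 := by fun_prop
        exact (continuous_const.sub (Continuous.div (by fun_prop) cη
          fun q => (h0 _).ne')).max continuous_const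
      · have hr := h0 p.2.1
        rw [max_eq_right]
        -- A zero coordinate does not crowd, since every level is at least `2 * η`.
        rw [sub_nonpos, one_le_div hr, zero_sub, abs_neg, abs_of_pos (hc0 p)]
        push_cast
        nlinarith [mul_nonneg (Nat.cast_nonneg (α := ℝ) i) hr.le]
    refine continuous_iff_continuousAt.2 fun p => ?_
    rcases lt_or_ge (crowding (η p.2.1) (2 * (i + 1 : ℕ) * η p.2.1) (f.realize p.1)) 1
      with hp | hp
    · have hev := hL.eventually_support_truncate_eq cf cc hc0 hex (ne_of_crowding_lt_one hp)
      let z (p : K.Realization × ℝ × ℝ) : K.Realization × ℝ :=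
        (f.transport (flow f k η i p) (truncate (2 * (i + 1 : ℕ) * η p.2.1) (f.realize p.1)),
          p.2.2 * max (1 - 2 * crowding (η p.2.1) (2 * (i + 1 : ℕ) * η p.2.1) (f.realize p.1)) 0)
      have hz : Continuous z := cx.prodMk (by fun_prop)
      have ht := hk.continuousOn (truncate (2 * (i + 1 : ℕ) * η p.2.1)
        (f.realize p.1)).coord.support (z p) (by
          change (f.realize _).coord.support = _
          rw [f.realize_transport (hs p)])
      refine (ht.tendsto.comp (tendsto_nhdsWithin_iff.2
        ⟨hz.tendsto p, hev.mono fun q hq => ?_⟩)).congr' ?_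
      · change (f.realize _).coord.support = _
        rw [f.realize_transport (hs q), hq]
      · filter_upwards [hev] with q hq
        rw [flow, hq]
        rfl
    · refine cx.continuousAt.congr ?_
      filter_upwards [(isOpen_lt (continuous_const (y := (1 / 2 : ℝ))) cθ).mem_nhds
        (show (1 / 2 : ℝ) < _ by linarith)] with q hq
      change (1 / 2 : ℝ) < crowding _ _ _ at hq
      rw [flow, max_eq_right (by linarith), mul_zero,
        hk.eq_self _ _ (by rw [f.realize_transport (hs q)])]

end

end Flow

end SimplicialMap

/-! ### From the flow to homotopy inverses. -/

theorem isClosed_closedSimplex (s : Finset V) : IsClosed (K.closedSimplex s) := by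
  rw [closedSimplex_eq_biInter]
  exact isClosed_biInter fun v _ => isClosed_eq (continuous_coord v) continuous_const

theorem IsLocallyFinite.locallyFinite_closedSimplex (hK : K.IsLocallyFinite) :
    LocallyFinite fun s : {s : Finset V // ∃ b : K.Realization, b.coord.support = s} =>
      K.closedSimplex s.1 := by
  intro x
  obtain ⟨v, hv⟩ := x.exists_mem_support
  refine ⟨_, (isOpen_star v).mem_nhds hv, ?_⟩
  refine ((hK v).preimage (f := Subtype.val) Subtype.val_injective.injOn).subset ?_
  rintro ⟨s, b, rfl⟩ ⟨y, hy, hy'⟩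
  exact ⟨b.support_mem, hy hy'⟩

namespace SimplicialMap

/-- A simplicial map with contractible point inverses has a family of homotopy inverses, together
with homotopies, whose control decreases to zero. -/
theorem exists_family_of_homotopyInverses (f : SimplicialMap K L) (hK : K.IsLocallyFinite)
    (hL : L.IsLocallyFinite) (hLd : L.IsFiniteDimensional)
    (hf : HasContractiblePointInverses f.realize) :
    ∃ (G : C(L.Realization × ℝ, K.Realization))
      (h₁ : (G.comp (f.realize.prodMap (ContinuousMap.id ℝ))).Homotopy ContinuousMap.fst)
      (h₂ : (f.realize.comp G).Homotopy ContinuousMap.fst),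
      (∀ p, L.standardDist p.1 (f.realize (G p)) ≤ ENNReal.ofReal (1 / (1 + |p.2|))) ∧
      (∀ t p, L.standardDist (f.realize p.1) (f.realize (h₁ (t, p))) ≤
        ENNReal.ofReal (1 / (1 + |p.2|))) ∧
      ∀ t p, L.standardDist p.1 (h₂ (t, p)) ≤ ENNReal.ofReal (1 / (1 + |p.2|)) := by
  obtain ⟨n, hn⟩ := hLd
  obtain ⟨k, hk⟩ := f.exists_isFibreContraction hK hf
  -- Chosen so that truncation at the top level `2 * (n + 2) * η r` moves points by at most `1 / (1
  -- + |r|)`; see `hηC`.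
  let η (r : ℝ) : ℝ := 1 / ((2 * (n + 2)) ^ 2 * (1 + |r|))
  have hr (r : ℝ) : 0 < 1 + |r| := by positivity
  have h0 (r : ℝ) : 0 < η r := by positivity
  have hη : Continuous η := by
    refine continuous_const.div (by fun_prop) fun r => ?_
    have := hr r
    positivity
  have hηC (r : ℝ) : 2 * (n + 1) * (2 * (n + 2) * η r) ≤ 1 / (1 + |r|) := by
    have : 2 * (n + 1) * (2 * (n + 2) * η r) = ((n + 1) / (n + 2)) * (1 / (1 + |r|)) := by
      have := (hr r).ne'
      have : (n + 2 : ℝ) ≠ 0 := by positivity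
      simp only [η]
      field_simp
    rw [this]
    refine mul_le_of_le_one_left (by positivity) (div_le_one_of_le₀ (by linarith) (by positivity))
  have h1 (r : ℝ) : (n + 1) * (2 * (n + 2) * η r) < 1 := by
    have e : 1 / (1 + |r|) ≤ 1 := div_le_one_of_le₀ (by linarith [abs_nonneg r]) (hr r).le
    nlinarith [hηC r]
  have hcont := continuous_flow hn h0 h1 hk hK hL hη le_rfl
  have hreal := realize_flow hn h0 h1 hk le_rfl
  have hdist (y : L.Realization) (r : ℝ) {c : ℝ} (hc : 0 ≤ c) (hc' : c ≤ 2 * (n + 2) * η r) :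
      L.standardDist y (truncate c y) ≤ ENNReal.ofReal (1 / (1 + |r|)) := by
    have h := mul_le_mul_of_nonneg_left hc' (by positivity : (0 : ℝ) ≤ n + 1)
    refine (hL.standardDist_truncate_le hn y hc (h.trans_lt (h1 r))).trans
      (ENNReal.ofReal_le_ofReal (le_trans ?_ (hηC r)))
    gcongr
  have hlev (r : ℝ) : 0 ≤ 2 * (n + 2) * η r := by
    have := h0 r
    positivity
  have hlevc {r : ℝ} {t : I} : 0 ≤ (1 - (t : ℝ)) * (2 * (n + 2) * η r) ∧
      (1 - (t : ℝ)) * (2 * (n + 2) * η r) ≤ 2 * (n + 2) * η r :=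
    ⟨mul_nonneg (sub_nonneg.2 t.2.2) (hlev r),
      mul_le_of_le_one_left (hlev r) (by linarith [t.2.1])⟩
  have hex (y : L.Realization) (r : ℝ) (t : I) :
      ∃ w ∈ y.coord.support, (1 - (t : ℝ)) * (2 * (n + 2) * η r) < y.coord w :=
    exists_lt_coord hn y ((mul_le_mul_of_nonneg_left hlevc.2 (by positivity)).trans_lt (h1 r))
  have hsub (y : L.Realization) (r : ℝ) (t : I) :
      (truncate ((1 - (t : ℝ)) * (2 * (n + 2) * η r)) y).coord.support ⊆ y.coord.support := by
    have := support_truncate_subset le_rfl hlevc.1 (hex y r t)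
    rwa [truncate_zero] at this
  have hsurj (y : L.Realization) : ∃ x, f.realize x = y := by
    have := hf y
    obtain ⟨x, hx⟩ := (inferInstance : Nonempty (f.realize ⁻¹' {y}))
    exact ⟨x, hx⟩
  -- An arbitrary, possibly discontinuous section; by `flow_one_eq` its choice does not affect `g`.
  choose lift hlift using hsurj
  let g (p : L.Realization × ℝ) : K.Realization := flow f k η (n + 2) (lift p.1, p.2, 1)
  have hg (x r) : g (f.realize x, r) = flow f k η (n + 2) (x, r, 1) :=
    flow_one_eq hn h0 h1 hk (hlift _) r
  -- Over the closed simplex carrying `b`, the section can be replaced by the continuous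
  -- `f.transport (lift b)`; these simplices form a locally finite closed cover.
  have hgc : Continuous g := by
    have hlf := hL.locallyFinite_closedSimplex.preimage_continuous
      (continuous_fst : Continuous (Prod.fst : L.Realization × ℝ → _))
    refine hlf.continuous (eq_univ_of_forall fun p => ?_)
      (fun s => (isClosed_closedSimplex _).preimage continuous_fst) ?_
    · exact mem_iUnion.2 ⟨⟨p.1.coord.support, _, rfl⟩, (Subset.rfl : _ ⊆ p.1.coord.support)⟩
    · rintro ⟨s, b, rfl⟩
      have hb (p : L.Realization × ℝ) (hp : p ∈ Prod.fst ⁻¹' L.closedSimplex b.coord.support) :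
          p.1.coord.support ⊆ (f.realize (lift b)).coord.support := by
        rw [hlift]
        exact hp
      have hc : ContinuousOn (fun p : L.Realization × ℝ =>
          flow f k η (n + 2) (f.transport (lift b) p.1, p.2, 1))
          (Prod.fst ⁻¹' L.closedSimplex b.coord.support) := by
        refine hcont.comp_continuousOn (ContinuousOn.prodMk ?_ (by fun_prop))
        exact (f.continuousOn_transport hK).comp (f := fun p : L.Realization × ℝ => (lift b, p.1))
          (by fun_prop) hb
      refine hc.congr fun p hp => ?_
      change g p = flow f k η (n + 2) (f.transport (lift b) p.1, p.2, 1)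
      rw [← hg, f.realize_transport (hb p hp)]
  let G : C(L.Realization × ℝ, K.Realization) := ⟨g, hgc⟩
  have hGc (p : L.Realization × ℝ) : f.realize (g p) = truncate (2 * (n + 2) * η p.2) p.1 := by
    rw [hreal]
    simp [hlift]
  have hct : Continuous fun q : I × K.Realization × ℝ =>
      truncate ((1 - (q.1 : ℝ)) * (2 * (n + 2) * η q.2.2)) (f.realize q.2.1) :=
    hL.continuous_truncate (by fun_prop) (by fun_prop) (fun q => hlevc.1) fun q => hex _ _ _
  have hctr := f.continuous_transport hK (continuous_fst.comp continuous_snd) hct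
    fun q => hsub (f.realize q.2.1) q.2.2 q.1
  let m : C(K.Realization × ℝ, K.Realization) :=
    ⟨fun p => f.transport p.1 (truncate (2 * (n + 2) * η p.2) (f.realize p.1)), by
      refine (hctr.comp (Continuous.prodMk_right (0 : I))).congr fun p => ?_
      simp⟩
  -- `F₁` undoes the contraction at fixed truncation; `F₂` then lowers the truncation level to `0`.
  let F₁ : (G.comp (f.realize.prodMap (ContinuousMap.id ℝ))).Homotopy m :=
    { toFun := fun q => flow f k η (n + 2) (q.2.1, q.2.2, 1 - q.1)
      continuous_toFun := hcont.comp (by fun_prop)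
      map_zero_left := fun p => by
        change flow f k η (n + 2) (p.1, p.2, 1 - ((0 : I) : ℝ)) = g (f.realize p.1, p.2)
        rw [hg, Icc.coe_zero, sub_zero]
      map_one_left := fun p => by
        change flow f k η (n + 2) (p.1, p.2, 1 - ((1 : I) : ℝ)) = f.transport p.1 _
        rw [Icc.coe_one, sub_self, flow_zero hn h0 h1 hk le_rfl]
        simp }
  let F₂ : m.Homotopy ContinuousMap.fst :=
    { toFun := fun q =>
        f.transport q.2.1 (truncate ((1 - (q.1 : ℝ)) * (2 * (n + 2) * η q.2.2)) (f.realize q.2.1))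
      continuous_toFun := hctr
      map_zero_left := fun p => by simp [m]
      map_one_left := fun p => by simp [truncate_zero, transport_self] }
  have hF₁ (q) : L.standardDist (f.realize q.2.1) (f.realize (F₁ q)) ≤
      ENNReal.ofReal (1 / (1 + |q.2.2|)) := by
    have e : f.realize (F₁ q) = truncate (2 * (n + 2) * η q.2.2) (f.realize q.2.1) :=
      (hreal _).trans (by simp)
    rw [e]
    exact hdist _ _ (hlev _) le_rfl
  have hF₂ (q) : L.standardDist (f.realize q.2.1) (f.realize (F₂ q)) ≤
      ENNReal.ofReal (1 / (1 + |q.2.2|)) := by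
    have e : f.realize (F₂ q) =
        truncate ((1 - (q.1 : ℝ)) * (2 * (n + 2) * η q.2.2)) (f.realize q.2.1) :=
      f.realize_transport (hsub _ _ _)
    rw [e]
    exact hdist _ _ hlevc.1 hlevc.2
  refine ⟨G, F₁.trans F₂,
    { toFun := fun q => truncate ((1 - (q.1 : ℝ)) * (2 * (n + 2) * η q.2.2)) q.2.1
      continuous_toFun := hL.continuous_truncate (by fun_prop) (by fun_prop)
        (fun q => hlevc.1) fun q => hex _ _ _
      map_zero_left := fun p => by simp [G, hGc]
      map_one_left := fun p => by simp [truncate_zero] }, fun p => ?_, fun t p => ?_, fun t p => ?_⟩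
  · change L.standardDist p.1 (f.realize (g p)) ≤ _
    rw [hGc]
    exact hdist _ _ (hlev _) le_rfl
  · rw [ContinuousMap.Homotopy.trans_apply]
    split_ifs
    exacts [hF₁ (_, p), hF₂ (_, p)]
  · exact hdist _ _ hlevc.1 hlevc.2

/-! ### From controlled homotopies back to contractible fibres. -/

/-- A point inverse is contractible if it can be deformed to a point within the inverse image of
the open star of the carrier of the point. -/
theorem contractibleSpace_of_homotopy (f : SimplicialMap K L) (hK : K.IsLocallyFinite)
    (y : L.Realization) (g : C(L.Realization, K.Realization))
    (h : (g.comp f.realize).Homotopy (ContinuousMap.id _))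
    (hg : y.coord.support ⊆ (f.realize (g y)).coord.support)
    (hh : ∀ t x, f.realize x = y → y.coord.support ⊆ (f.realize (h (t, x))).coord.support) :
    ContractibleSpace (f.realize ⁻¹' {y}) := by
  refine (contractible_iff_id_nullhomotopic _).2
    ⟨⟨f.transport (g y) y, f.realize_transport hg⟩, ⟨ContinuousMap.Homotopy.symm ?_⟩⟩
  -- Transporting `h` to `y` keeps it in the fibre; at time `0` it is constant because `f x = y`
  -- there.
  exact
    { toFun := fun z => ⟨f.transport (h (z.1, z.2.1)) y, f.realize_transport (hh _ _ z.2.2)⟩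
      continuous_toFun := (f.continuous_transport hK (by fun_prop) continuous_const
        fun z => hh _ _ z.2.2).subtype_mk _
      map_zero_left := fun x => Subtype.ext (by
        have hx : f.realize x.1 = y := x.2
        simp [hx])
      map_one_left := fun x => Subtype.ext (by
        have hx : f.realize x.1 = y := x.2
        exact (congrArg₂ f.transport (h.apply_one x.1) hx.symm).trans f.transport_self) }

end SimplicialMap

/-- The carrier of a point is contained in the carriers of the points near to it. -/
theorem Realization.exists_pos_support_subset (y : K.Realization) :
    ∃ ε : ℝ, 0 < ε ∧ ∀ z : K.Realization, (∀ v, |y.coord v - z.coord v| < ε) →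
      y.coord.support ⊆ z.coord.support := by
  obtain ⟨v, hv, hmin⟩ := Finset.exists_min_image _ (fun v => y.coord v) y.exists_mem_support
  -- The witness is the least positive coordinate of `y`.
  refine ⟨_, mem_support.1 hv, fun z hz w hw => mem_support.2 ?_⟩
  linarith [(abs_lt.1 (hz w)).2, hmin w hw]

end AbstractSimplicialComplex

/-! ### Distances in the open cone. -/

namespace OpenCone

variable {M : Type*}

theorem coningMap_eq_iff {a b : M × ℝ} :
    coningMap M a = coningMap M b ↔ a.2 = b.2 ∧ (a.2 ≤ 0 ∨ a.1 = b.1) :=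
  Quotient.eq (r := openConeSetoid M)

theorem pathDist_le_formulaDist (d : M → M → ℝ≥0∞) (P Q : OpenCone M) :
    pathDist d P Q ≤ formulaDist d P Q := by
  induction P, Q using Quotient.inductionOn₂ with | _ a b
  obtain ⟨m, t⟩ := a
  obtain ⟨m', s⟩ := b
  change _ ≤ ENNReal.ofReal (min t s) * d m m' + ENNReal.ofReal |t - s|
  rcases lt_trichotomy t s with h | rfl | h
  · refine iInf_le_of_le 2 (iInf_le_of_le
      (fun | 0 => (m, t) | 1 => (m', t) | _ => (m', s)) (iInf₂_le_of_le rfl rfl ?_))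
    simp [Finset.sum_range_succ, pieceLength, h.ne, min_eq_left h.le]
  -- One piece only: a repeated corner would cost `ENNReal.ofReal t * d m' m'`, and `d` need not
  -- vanish on the diagonal.
  · refine iInf_le_of_le 1 (iInf_le_of_le
      (fun | 0 => (m, t) | _ => (m', t)) (iInf₂_le_of_le rfl rfl ?_))
    simp [pieceLength]
  · refine iInf_le_of_le 2 (iInf_le_of_le
      (fun | 0 => (m, t) | 1 => (m, s) | _ => (m', s)) (iInf₂_le_of_le rfl rfl ?_))
    simp [Finset.sum_range_succ, pieceLength, h.ne', min_eq_right h.le, add_comm]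

/-- Points of a ball of radius `B` in the open cone with centre at height `c + B` are not far from
the centre when projected to the base. -/
theorem mul_abs_sub_lt_of_pathDist_lt {d : M → M → ℝ≥0∞} {ρ : M → ℝ}
    (hρ : ∀ m m', ENNReal.ofReal |ρ m - ρ m'| ≤ d m m') {m m' : M} {c B s : ℝ} (hc : 0 < c)
    (hB : 0 ≤ B) (h : pathDist d (coningMap M (m, c + B)) (coningMap M (m', s)) <
      ENNReal.ofReal B) : c * |ρ m - ρ m'| < B := by
  simp only [pathDist, iInf_lt_iff] at h
  obtain ⟨n, z, h0, hn, hsum⟩ := h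
  rw [coningMap_eq_iff] at h0 hn
  -- Used for the height, which thus stays above `c`, and then for `c * ρ`, since horizontal pieces
  -- above height `c` cost at least `c * d`.
  have hlen (φ : M × ℝ → ℝ) (k : ℕ) (hk : k ≤ n)
      (hφ : ∀ i < k, ENNReal.ofReal |φ (z i) - φ (z (i + 1))| ≤ pieceLength d (z i) (z (i + 1))) :
      |φ (z 0) - φ (z k)| < B := by
    rw [← ENNReal.ofReal_lt_ofReal_iff_of_nonneg (abs_nonneg _)]
    calc ENNReal.ofReal |φ (z 0) - φ (z k)|
        = edist (φ (z 0)) (φ (z k)) := by rw [edist_dist, Real.dist_eq]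
      _ ≤ ∑ i ∈ Finset.range k, edist (φ (z i)) (φ (z (i + 1))) :=
        edist_le_range_sum_edist (fun i => φ (z i)) k
      _ ≤ ∑ i ∈ Finset.range k, pieceLength d (z i) (z (i + 1)) :=
        Finset.sum_le_sum fun i hi => by
          rw [edist_dist, Real.dist_eq]
          exact hφ i (Finset.mem_range.1 hi)
      _ ≤ ∑ i ∈ Finset.range n, pieceLength d (z i) (z (i + 1)) :=
        Finset.sum_le_sum_of_subset (Finset.range_mono hk)
      _ < _ := hsum
  have hheight (k : ℕ) (hk : k ≤ n) : c < (z k).2 := by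
    have := hlen Prod.snd k hk fun i _ => by
      rw [pieceLength]
      split_ifs with h1 h2
      · simp [h1]
      · exact le_rfl
      · exact le_top
    have h2 := h0.1
    dsimp only at h2
    linarith [(abs_lt.1 this).2]
  have hbase := hlen (fun p => c * ρ p.1) n le_rfl fun i hi => by
    rw [← mul_sub, abs_mul, abs_of_pos hc, ENNReal.ofReal_mul hc.le, pieceLength]
    split_ifs with h1 h2
    · exact mul_le_mul' (ENNReal.ofReal_le_ofReal (hheight i hi.le).le) (hρ _ _)
    · simp [h2]
    · exact le_top
  -- At positive height a point of the cone determines its base point.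
  have e0 : (z 0).1 = m := h0.2.resolve_left (by linarith [hheight 0 n.zero_le])
  have en : (z n).1 = m' := hn.2.resolve_left (by linarith [hheight n le_rfl])
  rw [← mul_sub, abs_mul, abs_of_pos hc, e0, en] at hbase
  exact hbase

end OpenCone

theorem IsBoundedHomotopyEquiv.mono {A B M : Type*} [TopologicalSpace A] [TopologicalSpace B]
    {d d' : M → M → ℝ≥0∞} (hd : ∀ m m', d m m' ≤ d' m m') {p : A → M} {q : B → M} {f : C(A, B)}
    (h : IsBoundedHomotopyEquiv d' p q f) : IsBoundedHomotopyEquiv d p q f := by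
  obtain ⟨b, hb, hf, g, h₁, h₂, hg, hh₁, hh₂⟩ := h
  exact ⟨b, hb, fun a => (hd _ _).trans_lt (hf a), g, h₁, h₂, fun a => (hd _ _).trans_lt (hg a),
    fun a => (hd _ _).trans_lt (hh₁ a), fun a => (hd _ _).trans_lt (hh₂ a)⟩

/-! ### The implications between the conditions. -/

namespace AbstractSimplicialComplex.SimplicialMap

open Topology Filter Set Realization

variable {V W : Type*} {K : AbstractSimplicialComplex V} {L : AbstractSimplicialComplex W}
  (f : SimplicialMap K L)

theorem isControlledHomotopyEquiv (hK : K.IsLocallyFinite)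
    (hL : L.IsLocallyFinite) (hLd : L.IsFiniteDimensional)
    (hf : HasContractiblePointInverses f.realize) {ε : ℝ} (hε : 0 < ε) :
    IsControlledHomotopyEquiv L.standardDist f.realize id (ENNReal.ofReal ε) f.realize := by
  obtain ⟨G, h₁, h₂, hG, hh₁, hh₂⟩ := f.exists_family_of_homotopyInverses hK hL hLd hf
  -- The slice of the family at height `1 / ε` has control below `ε`.
  have hlt : ENNReal.ofReal (1 / (1 + |1 / ε|)) < ENNReal.ofReal ε := by
    rw [ENNReal.ofReal_lt_ofReal_iff hε, abs_of_pos (by positivity), div_lt_iff₀ (by positivity),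
      mul_add, mul_one_div_cancel hε.ne']
    linarith
  refine ⟨rfl, G.comp ((ContinuousMap.id _).prodMk (ContinuousMap.const _ (1 / ε))),
    { toFun := fun q => h₁ (q.1, (q.2, 1 / ε))
      continuous_toFun := by fun_prop
      map_zero_left := fun x => h₁.apply_zero _
      map_one_left := fun x => h₁.apply_one _ },
    { toFun := fun q => h₂ (q.1, (q.2, 1 / ε))
      continuous_toFun := by fun_prop
      map_zero_left := fun x => h₂.apply_zero _
      map_one_left := fun x => h₂.apply_one _ }, ?_, ?_, ?_⟩
  · exact fun y => (hG (y, 1 / ε)).trans_lt hlt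
  · exact fun q => (hh₁ q.1 (q.2, 1 / ε)).trans_lt hlt
  · exact fun q => (hh₂ q.1 (q.2, 1 / ε)).trans_lt hlt

/-- All maps preserve the height `r`, so only the horizontal term counts, and it is at most `r / (1
+ r) ≤ 1` for `r ≥ 0` and `0` otherwise. -/
theorem isBoundedHomotopyEquiv_formulaDist (hK : K.IsLocallyFinite)
    (hL : L.IsLocallyFinite) (hLd : L.IsFiniteDimensional)
    (hf : HasContractiblePointInverses f.realize) :
    IsBoundedHomotopyEquiv (OpenCone.formulaDist L.standardDist)
      (OpenCone.coningMap L.Realization ∘ f.realize.prodMap (ContinuousMap.id ℝ))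
      (OpenCone.coningMap L.Realization) (f.realize.prodMap (ContinuousMap.id ℝ)) := by
  obtain ⟨G, h₁, h₂, hG, hh₁, hh₂⟩ := f.exists_family_of_homotopyInverses hK hL hLd hf
  have key {y y' : L.Realization} {r : ℝ}
      (h : L.standardDist y y' ≤ ENNReal.ofReal (1 / (1 + |r|))) :
      OpenCone.formulaDist L.standardDist (OpenCone.coningMap _ (y, r))
        (OpenCone.coningMap _ (y', r)) < 2 := by
    change ENNReal.ofReal (min r r) * L.standardDist y y' + ENNReal.ofReal |r - r| < 2
    rw [min_self, sub_self, abs_zero, ENNReal.ofReal_zero, add_zero]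
    refine lt_of_le_of_lt (b := 1) ?_ (by norm_num)
    refine (mul_le_mul_right h _).trans ?_
    rcases le_total r 0 with hr | hr
    · simp [ENNReal.ofReal_of_nonpos hr]
    · rw [← ENNReal.ofReal_mul hr, ENNReal.ofReal_le_one, abs_of_nonneg hr, mul_one_div]
      exact div_le_one_of_le₀ (by linarith) (by linarith)
  have hself (y : L.Realization) : L.standardDist y y = 0 := by
    have := hL.standardDist_le y y Subset.rfl
    simpa using this
  refine ⟨2, by simp, fun p => key (by simp [hself]),
    G.prodMk ContinuousMap.snd,
    { toFun := fun q => (h₁ q, q.2.2)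
      continuous_toFun := by fun_prop
      map_zero_left := fun p => Prod.ext (h₁.apply_zero p) rfl
      map_one_left := fun p => Prod.ext (h₁.apply_one p) rfl },
    { toFun := fun q => (h₂ q, q.2.2)
      continuous_toFun := by fun_prop
      map_zero_left := fun p => Prod.ext (h₂.apply_zero p) rfl
      map_one_left := fun p => Prod.ext (h₂.apply_one p) rfl }, ?_, ?_, ?_⟩
  · exact fun p => key (hG p)
  · exact fun q => key (hh₁ q.1 q.2)
  · exact fun q => key (hh₂ q.1 q.2)

theorem hasContractiblePointInverses_of_controlled (hK : K.IsLocallyFinite)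
    (h : ∀ ε : ℝ, 0 < ε →
      IsControlledHomotopyEquiv L.standardDist f.realize id (ENNReal.ofReal ε) f.realize) :
    HasContractiblePointInverses f.realize := by
  intro y
  obtain ⟨ε, hε, hy⟩ := y.exists_pos_support_subset
  obtain ⟨-, g, h₁, -, hg, hh₁, -⟩ := h ε hε
  have key (z : L.Realization) (hz : L.standardDist y z < ENNReal.ofReal ε) :
      y.coord.support ⊆ z.coord.support :=
    hy z fun w => (ENNReal.ofReal_lt_ofReal_iff hε).1
      ((abs_coord_sub_le_standardDist y z w).trans_lt hz)
  refine f.contractibleSpace_of_homotopy hK y g h₁ (key _ (hg y)) fun t x hx => key _ ?_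
  rw [← hx]
  exact hh₁ (t, x)

theorem hasContractiblePointInverses_of_bounded (hK : K.IsLocallyFinite)
    (h : IsBoundedHomotopyEquiv (OpenCone.pathDist L.standardDist)
      (OpenCone.coningMap L.Realization ∘ f.realize.prodMap (ContinuousMap.id ℝ))
      (OpenCone.coningMap L.Realization) (f.realize.prodMap (ContinuousMap.id ℝ))) :
    HasContractiblePointInverses f.realize := by
  intro y
  obtain ⟨ε, hε, hy⟩ := y.exists_pos_support_subset
  obtain ⟨b, hb, -, g, h₁, -, hg, hh₁, -⟩ := h
  rw [← ENNReal.ofReal_toReal hb.ne] at hg hh₁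
  set B := b.toReal
  have hB : 0 ≤ B := ENNReal.toReal_nonneg
  -- Above this height, a path of length less than `B` changes each coordinate by less than `ε * B /
  -- (B + 1)`, hence by less than `ε`.
  have hc : 0 < (B + 1) / ε := by positivity
  have key (z : L.Realization) (s : ℝ)
      (hz : OpenCone.pathDist L.standardDist (OpenCone.coningMap _ (y, (B + 1) / ε + B))
        (OpenCone.coningMap _ (z, s)) < ENNReal.ofReal B) :
      y.coord.support ⊆ z.coord.support := by
    refine hy z fun w => ?_
    have := OpenCone.mul_abs_sub_lt_of_pathDist_lt
      (fun y z => abs_coord_sub_le_standardDist y z w) hc hB hz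
    by_contra! hle
    have h2 := mul_le_mul_of_nonneg_left hle hc.le
    rw [div_mul_cancel₀ _ hε.ne'] at h2
    linarith
  -- Restrict to one slice, `B` higher so that paths cannot descend below `(B + 1) / ε`, and discard
  -- the resulting heights.
  refine f.contractibleSpace_of_homotopy hK y (ContinuousMap.fst.comp (g.comp
    ((ContinuousMap.id _).prodMk (ContinuousMap.const _ ((B + 1) / ε + B)))))
    { toFun := fun q => (h₁ (q.1, (q.2, (B + 1) / ε + B))).1
      continuous_toFun := by fun_prop
      map_zero_left := fun x => congrArg Prod.fst (h₁.apply_zero (x, (B + 1) / ε + B))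
      map_one_left := fun x => congrArg Prod.fst (h₁.apply_one (x, (B + 1) / ε + B)) }
    (key _ _ (hg (y, (B + 1) / ε + B))) fun t x hx => key _ (h₁ (t, (x, (B + 1) / ε + B))).2 ?_
  rw [← hx]
  exact hh₁ (t, (x, (B + 1) / ε + B))

end AbstractSimplicialComplex.SimplicialMap

end

theorem theorem6p1 {V W : Type*}
    (X : AbstractSimplicialComplex V) (Y : AbstractSimplicialComplex W)
    (hXfd : X.IsFiniteDimensional) (hXlf : X.IsLocallyFinite)
    (hYfd : Y.IsFiniteDimensional) (hYlf : Y.IsLocallyFinite)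
    (f : AbstractSimplicialComplex.SimplicialMap X Y) :
    List.TFAE [
      HasContractiblePointInverses f.realize,
      ∀ ε : ℝ, 0 < ε →
        IsControlledHomotopyEquiv Y.standardDist f.realize id (ENNReal.ofReal ε) f.realize,
      IsBoundedHomotopyEquiv (OpenCone.pathDist Y.standardDist)
        (OpenCone.coningMap Y.Realization ∘ f.realize.prodMap (ContinuousMap.id ℝ))
        (OpenCone.coningMap Y.Realization)
        (f.realize.prodMap (ContinuousMap.id ℝ)),
      IsBoundedHomotopyEquiv (OpenCone.formulaDist Y.standardDist)
        (OpenCone.coningMap Y.Realization ∘ f.realize.prodMap (ContinuousMap.id ℝ))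
        (OpenCone.coningMap Y.Realization)
        (f.realize.prodMap (ContinuousMap.id ℝ))] := by
  tfae_have 1 → 2 := fun h _ hε => f.isControlledHomotopyEquiv hXlf hYlf hYfd h hε
  tfae_have 2 → 1 := f.hasContractiblePointInverses_of_controlled hXlf
  tfae_have 1 → 4 := f.isBoundedHomotopyEquiv_formulaDist hXlf hYlf hYfd
  tfae_have 4 → 3 := IsBoundedHomotopyEquiv.mono (OpenCone.pathDist_le_formulaDist _)
  tfae_have 3 → 1 := f.hasContractiblePointInverses_of_bounded hXlf
  tfae_finish
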